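/- Let $m,p\ge 1$ be fixed, let $a_r\in\mathbb C^m$ and $a_t\in\mathbb C^p$ be the steering vectors, and for every $n$ let $S_n\in\mathbb C^{p\times n}$ be the known waveform. Put $Z_n=a_ra_t^HS_n\in\mathbb C^{m\times n}$, with entries $z_{ij}=u_{ij}+\imath v_{ij}$, and $N=mn$. Assume that $\operatorname{tr}(Z_nZ_n^H)=N$ for all $n$ and that $\max_{i,j}|z_{ij}|^2/n\to 0$ as $n\to\infty$ (for example, the entries of the waveforms are bounded uniformly in $n$). The one-bit data are $Y=\mathcal Q(\beta Z_n+\mathcal N)$, where $\mathcal Q(X)=\operatorname{sign}(\operatorname{Re}X)+\imath\operatorname{sign}(\operatorname{Im}X)$ entrywise, $\beta=a+\imath b\in\mathbb C$ is the unknown target reflectivity, and the real and imaginary parts of the entries of the noise $\mathcal N$ are i.i.d. standard normal (noise variance $2$). With $Q(x)=\int_x^\infty(2\pi)^{-1/2}e^{-t^2/2}\,dt$ and the entries $r_{ij}+\imath s_{ij}$ of $Y$, the log-likelihood is $$\mathcal L(Y;a,b)=\sum_{i,j}\log Q\big(-r_{ij}(au_{ij}-bv_{ij})\big)+\sum_{i,j}\log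 Q\big(-s_{ij}(av_{ij}+bu_{ij})\big).$$ Let $F(a,b)$ be the Fisher information matrix, that is, the expectation of $\nabla\mathcal L\,(\nabla\mathcal L)^T$ when $Y$ is generated with $\beta=a+\imath b$. Rao's statistic is $T_R=\nabla\mathcal L(Y;0,0)^TF(0,0)^{-1}\nabla\mathcal L(Y;0,0)$. Let $w=(w_1,w_2)^T=N^{-1/2}\big(\operatorname{Re}(z^Hy),\operatorname{Im}(z^Hy)\big)^T$, where $z=\operatorname{vec}(Z_n)$ and $y=\operatorname{vec}(Y)$. With $c_{ij}=1-2Q(au_{ij}-bv_{ij})$ and $d_{ij}=1-2Q(av_{ij}+bu_{ij})$, define $$u_w(\beta)=\frac1{\sqrt N}\begin{bmatrix}\sum_{i,j}(c_{ij}u_{ij}+d_{ij}v_{ij})\\ \sum_{i,j}(d_{ij}u_{ij}-c_{ij}v_{ij})\end{bmatrix},\qquad \Sigma_w(\beta)=\begin{bmatrix}\sigma_1^2&\sigma_{12}\\ \sigma_{12}&\sigma_2^2\end{bmatrix},$$ $$\sigma_1^2=1-\frac1N\sum_{i,j}(c_{ij}^2u_{ij}^2+d_{ij}^2v_{ij}^2),\quad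 \sigma_2^2=1-\frac1N\sum_{i,j}(c_{ij}^2v_{ij}^2+d_{ij}^2u_{ij}^2),\quad \sigma_{12}=\frac1N\sum_{i,j}(c_{ij}^2-d_{ij}^2)u_{ij}v_{ij}.$$ Under $\mathcal H_0$, i.e. $\beta=0$ and $Y=\mathcal Q(\mathcal N)$, the following hold. 1. For every $n\ge1$, $T_R=|\operatorname{tr}(YZ_n^H)|^2/N=w_1^2+w_2^2$. 2. For every $n\ge1$, $u_w(0)=0$ and $\Sigma_w(0)=I_2$, and these are the mean vector and the covariance matrix of $w$. 3. As $n\to\infty$, $w$ converges in distribution to $\mathcal N(0,I_2)$, and $T_R$ converges in distribution to $\chi^2_2$, which is the exponential distribution with rate $1/2$, i.e. with mean $2$. 4. For every threshold $\gamma\ge0$, $\Pr\{\chi_2^2>\gamma\}=e^{-\gamma/2}$, and the probability of false alarm satisfies $P_{\rm fa}(\gamma)=\Pr\{T_R>\gamma\}\to e^{-\gamma/2}$ as $n\to\infty$. 5. For every $\alpha\in(0,1]$, the only real $\gamma$ with $e^{-\gamma/2}=\alpha$ is $\gamma=-2\log\alpha$; it is nonnegative, and with this threshold the probability of false alarm tends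 to $\alpha$ as $n\to\infty$. -/

import Mathlib

open MeasureTheory ProbabilityTheory Filter Topology
open scoped Matrix ENNReal

noncomputable section

namespace OneBitRadar

/-- The Gaussian tail function `Q(x) = ∫_x^∞ (2π)^{-1/2} exp(-t²/2) dt`. -/
def Q (x : ℝ) : ℝ :=
  ∫ t in Set.Ioi x, 1 / Real.sqrt (2 * Real.pi) * Real.exp (-t ^ 2 / 2)

/-- The one-bit quantizer `sign(Re X) + ι sign(Im X)`, entry by entry. -/
def quantize {m n : ℕ} (X : Matrix (Fin m) (Fin n) ℂ) : Matrix (Fin m) (Fin n) ℂ :=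
  Matrix.of fun i j => ⟨Real.sign (X i j).re, Real.sign (X i j).im⟩

/-- The target response `Z = a_r a_tᴴ S`. -/
def response {m p n : ℕ} (aR : Fin m → ℂ) (aT : Fin p → ℂ) (S : Matrix (Fin p) (Fin n) ℂ) :
    Matrix (Fin m) (Fin n) ℂ :=
  Matrix.vecMulVec aR (star aT ᵥ* S)

/-- The law of one entry of the noise: independent standard normal real and imaginary parts
(a circular complex Gaussian of variance `2`). -/
def complexGaussian : Measure ℂ :=
  ((gaussianReal 0 1).prod (gaussianReal 0 1)).map fun x : ℝ × ℝ => (⟨x.1, x.2⟩ : ℂ)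

instance isProbabilityMeasure_complexGaussian : IsProbabilityMeasure complexGaussian :=
  Measure.isProbabilityMeasure_map Complex.measurableEquivRealProd.symm.measurable.aemeasurable

/-- White Gaussian noise of variance `2`: the entries of the `m × n` matrix are i.i.d. -/
def noiseLaw (m n : ℕ) : Measure (Fin m → Fin n → ℂ) :=
  Measure.pi fun _ => Measure.pi fun _ => complexGaussian

instance isProbabilityMeasure_noiseLaw (m n : ℕ) : IsProbabilityMeasure (noiseLaw m n) := by
  unfold noiseLaw
  infer_instance

/-- The log-likelihood of the one-bit data `Y` (with entries `r + ι s`) when the target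
reflectivity is `β = a + ι b`, the response has the entries `u + ι v` and the noise variance
is `2`. -/
def logLik {m n : ℕ} (Z Y : Matrix (Fin m) (Fin n) ℂ) (β : ℂ) : ℝ :=
  (∑ i, ∑ j, Real.log (Q (-(Y i j).re * (β.re * (Z i j).re - β.im * (Z i j).im)))) +
    ∑ i, ∑ j, Real.log (Q (-(Y i j).im * (β.re * (Z i j).im + β.im * (Z i j).re)))

/-- The score: the gradient of the log-likelihood in the real parameters `(a, b)`. -/
def score {m n : ℕ} (Z Y : Matrix (Fin m) (Fin n) ℂ) (β : ℂ) : Fin 2 → ℝ :=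
  ![deriv (fun a : ℝ => logLik Z Y ⟨a, β.im⟩) β.re,
    deriv (fun b : ℝ => logLik Z Y ⟨β.re, b⟩) β.im]

/-- The Fisher information matrix: the expectation of `score * scoreᵀ` when the data are
`Y = quantize (β Z + N)`. -/
def fisherInfo {m n : ℕ} (Z : Matrix (Fin m) (Fin n) ℂ) (β : ℂ) : Matrix (Fin 2) (Fin 2) ℝ :=
  Matrix.of fun k l => ∫ N, score Z (quantize (β • Z + Matrix.of N)) β k *
    score Z (quantize (β • Z + Matrix.of N)) β l ∂(noiseLaw m n)

/-- Rao's test statistic for `β = 0` against `β ≠ 0`. -/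
def raoStat {m n : ℕ} (Z Y : Matrix (Fin m) (Fin n) ℂ) : ℝ :=
  score Z Y 0 ⬝ᵥ ((fisherInfo Z 0)⁻¹ *ᵥ score Z Y 0)

/-- `zᴴ y`, where `z` and `y` are the vectorizations of `Z` and `Y`. -/
def zHy {m n : ℕ} (Z Y : Matrix (Fin m) (Fin n) ℂ) : ℂ :=
  ∑ i, ∑ j, star (Z i j) * Y i j

/-- `w = (Re (zᴴ y), Im (zᴴ y)) / √N` with `N = m n`. -/
def wVec {m n : ℕ} (Z Y : Matrix (Fin m) (Fin n) ℂ) : EuclideanSpace ℝ (Fin 2) :=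
  !₂[(zHy Z Y).re / Real.sqrt ((m : ℝ) * n), (zHy Z Y).im / Real.sqrt ((m : ℝ) * n)]

/-- The mean `1 - 2 Q(a u - b v)` of the real part of one sample. -/
def cCoef (β z : ℂ) : ℝ := 1 - 2 * Q (β.re * z.re - β.im * z.im)

/-- The mean `1 - 2 Q(a v + b u)` of the imaginary part of one sample. -/
def dCoef (β z : ℂ) : ℝ := 1 - 2 * Q (β.re * z.im + β.im * z.re)

/-- The mean vector `u_w(β)` of the Gaussian approximation of `w`. -/
def uW {m n : ℕ} (Z : Matrix (Fin m) (Fin n) ℂ) (β : ℂ) : EuclideanSpace ℝ (Fin 2) :=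
  (1 / Real.sqrt ((m : ℝ) * n)) •
    !₂[∑ i, ∑ j, (cCoef β (Z i j) * (Z i j).re + dCoef β (Z i j) * (Z i j).im),
      ∑ i, ∑ j, (dCoef β (Z i j) * (Z i j).re - cCoef β (Z i j) * (Z i j).im)]

/-- The off-diagonal entry of `Σ_w(β)`. -/
def sigma12 {m n : ℕ} (Z : Matrix (Fin m) (Fin n) ℂ) (β : ℂ) : ℝ :=
  1 / ((m : ℝ) * n) * ∑ i, ∑ j,
    (cCoef β (Z i j) ^ 2 - dCoef β (Z i j) ^ 2) * (Z i j).re * (Z i j).im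

/-- The covariance matrix `Σ_w(β)` of the Gaussian approximation of `w`. -/
def sigmaW {m n : ℕ} (Z : Matrix (Fin m) (Fin n) ℂ) (β : ℂ) : Matrix (Fin 2) (Fin 2) ℝ :=
  !![1 - 1 / ((m : ℝ) * n) * ∑ i, ∑ j,
        (cCoef β (Z i j) ^ 2 * (Z i j).re ^ 2 + dCoef β (Z i j) ^ 2 * (Z i j).im ^ 2),
      sigma12 Z β;
      sigma12 Z β,
      1 - 1 / ((m : ℝ) * n) * ∑ i, ∑ j,
        (cCoef β (Z i j) ^ 2 * (Z i j).im ^ 2 + dCoef β (Z i j) ^ 2 * (Z i j).re ^ 2)]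

/-- The central chi-squared law with `f` degrees of freedom: the law of the sum of the squares
of `f` independent standard normal variables. -/
def chiSquared (f : ℕ) : Measure ℝ :=
  (Measure.pi fun _ : Fin f => gaussianReal 0 1).map fun x => ∑ k, x k ^ 2

instance isProbabilityMeasure_chiSquared (f : ℕ) : IsProbabilityMeasure (chiSquared f) :=
  Measure.isProbabilityMeasure_map (by
    have h : Measurable fun x : Fin f → ℝ => ∑ k, x k ^ 2 := by fun_prop
    exact h.aemeasurable)

end OneBitRadar

end

/-! ### The Gaussian tail near zero and the score at the null hypothesis -/

namespace OneBitRadar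

/-! At `β = 0` every factor of the likelihood is `Q 0 = 1 / 2`, and the logarithmic derivative of
`Q` there is a constant. Hence the score is a constant times `(Re zᴴy, Im zᴴy)`
(`score_zero_apply`). Under the null hypothesis the data are independent fair signs. The two
coefficient vectors of a sample, `(u, v)` and `(-v, u)`, are orthogonal with squared length `|z|²`
(`weight_mul_add`), so the Fisher information and the covariance of `w` are both scalar matrices.
The constant cancels in Rao's statistic, which leaves `|zᴴy|² / N` (`raoStat_eq`).

Each inner product `⟨w, t⟩` is a weighted sum of signs, so its characteristic function is a product
of cosines (`integral_exp_signSum`). Replacing each cosine by the Gaussian `exp (-x² / 2)` costs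
`O(x⁴)`. The squared weights add up to `‖t‖²`, and the largest tends to zero by the negligibility
assumption, so the total error vanishes (`abs_prod_cos_mul_cos_sub_exp_le`). Lévy's continuity
theorem then gives the normal limit, and continuous mapping gives the chi-squared limit. Comparing
characteristic functions identifies the latter with an exponential law
(`chiSquared_two_eq_expMeasure`). That law has no atoms, so the tail probabilities converge at every
threshold. -/

lemma gaussianDensity_eq (t : ℝ) :
    1 / Real.sqrt (2 * Real.pi) * Real.exp (-t ^ 2 / 2) =
      1 / Real.sqrt (2 * Real.pi) * Real.exp (-(1 / 2) * t ^ 2) := by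
  ring_nf

lemma integrable_gaussianDensity :
    Integrable fun t : ℝ => 1 / Real.sqrt (2 * Real.pi) * Real.exp (-t ^ 2 / 2) := by
  simp_rw [gaussianDensity_eq]
  exact (integrable_exp_neg_mul_sq (by norm_num)).const_mul _

lemma Q_zero : Q 0 = 1 / 2 := by
  unfold Q
  simp_rw [gaussianDensity_eq]
  rw [integral_const_mul, integral_gaussian_Ioi, show Real.pi / (1 / 2) = 2 * Real.pi by ring]
  have : Real.sqrt (2 * Real.pi) ≠ 0 := by positivity
  field_simp

/-- With `x` as an endpoint of an interval integral, the fundamental theorem of calculus applies. -/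
lemma Q_eq_sub_intervalIntegral (x : ℝ) :
    Q x = Q 0 - ∫ t in (0 : ℝ)..x, 1 / Real.sqrt (2 * Real.pi) * Real.exp (-t ^ 2 / 2) := by
  unfold Q
  rw [← intervalIntegral.integral_Ioi_sub_Ioi' integrable_gaussianDensity.integrableOn
    integrable_gaussianDensity.integrableOn]
  ring

lemma hasDerivAt_Q (x : ℝ) :
    HasDerivAt Q (-(1 / Real.sqrt (2 * Real.pi) * Real.exp (-x ^ 2 / 2))) x := by
  have hc : Continuous fun t : ℝ => 1 / Real.sqrt (2 * Real.pi) * Real.exp (-t ^ 2 / 2) := by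
    fun_prop
  rw [funext Q_eq_sub_intervalIntegral]
  exact (intervalIntegral.integral_hasDerivAt_right (hc.intervalIntegrable _ _)
    (hc.stronglyMeasurableAtFilter _ _) hc.continuousAt).const_sub _

/-- The factor is `Q'(0) / Q(0)`, where `Q'(0) = -1 / √(2π)` and `Q(0) = 1 / 2`. -/
lemma hasDerivAt_log_Q_mul (k : ℝ) :
    HasDerivAt (fun a : ℝ => Real.log (Q (a * k))) (-(2 / Real.sqrt (2 * Real.pi)) * k) 0 := by
  have h0 : HasDerivAt (fun a : ℝ => a * k) k 0 := by
    simpa using (hasDerivAt_id (0 : ℝ)).mul_const k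
  have h1 : HasDerivAt Q (-(1 / Real.sqrt (2 * Real.pi))) ((0 : ℝ) * k) := by
    simpa using hasDerivAt_Q ((0 : ℝ) * k)
  have h2 := (h1.comp (0 : ℝ) h0).log (by simp [Q_zero])
  convert! h2 using 1
  simp [Q_zero]
  ring

/-- The weight of the real parts of the data in the two coordinates of `zᴴ y`. -/
noncomputable def reWeight (k : Fin 2) (z : ℂ) : ℝ := ![z.re, -z.im] k

/-- The weight of the imaginary parts of the data in the two coordinates of `zᴴ y`. -/
noncomputable def imWeight (k : Fin 2) (z : ℂ) : ℝ := ![z.im, z.re] k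

variable {m n : ℕ}

lemma zHy_re (Z Y : Matrix (Fin m) (Fin n) ℂ) :
    (zHy Z Y).re =
      ∑ i, ∑ j, (reWeight 0 (Z i j) * (Y i j).re + imWeight 0 (Z i j) * (Y i j).im) := by
  simp [zHy, reWeight, imWeight, Complex.re_sum]

lemma zHy_im (Z Y : Matrix (Fin m) (Fin n) ℂ) :
    (zHy Z Y).im =
      ∑ i, ∑ j, (reWeight 1 (Z i j) * (Y i j).re + imWeight 1 (Z i j) * (Y i j).im) := by
  simp only [zHy, reWeight, imWeight, Complex.im_sum, Complex.mul_im]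
  simp only [RCLike.star_def, Complex.conj_re, Complex.conj_im, Matrix.cons_val_one,
    Matrix.cons_val_zero]
  refine Finset.sum_congr rfl fun i _ => Finset.sum_congr rfl fun j _ => ?_
  ring

lemma trace_mul_conjTranspose (Z Y : Matrix (Fin m) (Fin n) ℂ) :
    (Y * Zᴴ).trace = zHy Z Y := by
  simp [Matrix.trace, Matrix.mul_apply, zHy, mul_comm]

/-- The coordinates of `zᴴ y` as linear functions of the data. -/
noncomputable def corr (k : Fin 2) (Z Y : Matrix (Fin m) (Fin n) ℂ) : ℝ :=
  ∑ i, ∑ j, (reWeight k (Z i j) * (Y i j).re + imWeight k (Z i j) * (Y i j).im)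

lemma normSq_zHy (Z Y : Matrix (Fin m) (Fin n) ℂ) :
    ‖zHy Z Y‖ ^ 2 = corr 0 Z Y ^ 2 + corr 1 Z Y ^ 2 := by
  rw [Complex.sq_norm, Complex.normSq_apply, zHy_re, zHy_im, corr, corr]
  ring

lemma wVec_apply (Z Y : Matrix (Fin m) (Fin n) ℂ) (k : Fin 2) :
    wVec Z Y k = corr k Z Y / Real.sqrt ((m : ℝ) * n) := by
  fin_cases k <;> simp [wVec, corr, zHy_re, zHy_im]

lemma hasDerivAt_sum_log_Q (A B : Fin m → Fin n → ℝ) :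
    HasDerivAt (fun a : ℝ => (∑ i, ∑ j, Real.log (Q (a * A i j))) +
      ∑ i, ∑ j, Real.log (Q (a * B i j)))
      (-(2 / Real.sqrt (2 * Real.pi)) * ∑ i, ∑ j, (A i j + B i j)) 0 := by
  have h (C : Fin m → Fin n → ℝ) : HasDerivAt (fun a : ℝ => ∑ i, ∑ j, Real.log (Q (a * C i j)))
      (∑ i, ∑ j, -(2 / Real.sqrt (2 * Real.pi)) * C i j) 0 :=
    HasDerivAt.fun_sum fun i _ => HasDerivAt.fun_sum fun j _ => hasDerivAt_log_Q_mul _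
  convert! (h A).add (h B) using 1
  simp only [Finset.sum_add_distrib, Finset.mul_sum, mul_add]

lemma score_zero_apply (Z Y : Matrix (Fin m) (Fin n) ℂ) (k : Fin 2) :
    score Z Y 0 k = 2 / Real.sqrt (2 * Real.pi) * corr k Z Y := by
  fin_cases k
  · have h := (hasDerivAt_sum_log_Q (fun i j => -(Y i j).re * (Z i j).re)
      fun i j => -(Y i j).im * (Z i j).im).deriv
    -- With the other parameter frozen at zero, each argument of `Q` is a multiple of the moving
    -- parameter.
    have e : (fun a : ℝ => logLik Z Y ⟨a, (0 : ℂ).im⟩) = fun a : ℝ =>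
        (∑ i, ∑ j, Real.log (Q (a * (-(Y i j).re * (Z i j).re)))) +
          ∑ i, ∑ j, Real.log (Q (a * (-(Y i j).im * (Z i j).im))) := by
      funext a
      simp only [logLik, Complex.zero_im, zero_mul, sub_zero, add_zero, mul_left_comm]
    simp only [score, Fin.zero_eta, Matrix.cons_val_zero, e, Complex.zero_re, h, corr]
    rw [neg_mul, ← mul_neg, ← Finset.sum_neg_distrib]
    congr 1
    refine Finset.sum_congr rfl fun i _ => ?_
    rw [← Finset.sum_neg_distrib]
    refine Finset.sum_congr rfl fun j _ => ?_
    simp [reWeight, imWeight]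
    ring
  · have h := (hasDerivAt_sum_log_Q (fun i j => (Y i j).re * (Z i j).im)
      fun i j => -(Y i j).im * (Z i j).re).deriv
    have e : (fun b : ℝ => logLik Z Y ⟨(0 : ℂ).re, b⟩) = fun b : ℝ =>
        (∑ i, ∑ j, Real.log (Q (b * ((Y i j).re * (Z i j).im)))) +
          ∑ i, ∑ j, Real.log (Q (b * (-(Y i j).im * (Z i j).re))) := by
      funext b
      simp only [logLik, Complex.zero_re, zero_mul, zero_sub, zero_add, mul_left_comm,
        neg_mul_neg]
    simp only [score, Fin.mk_one, Matrix.cons_val_one, Matrix.cons_val_zero, e, Complex.zero_im,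
      h, corr]
    rw [neg_mul, ← mul_neg, ← Finset.sum_neg_distrib]
    congr 1
    refine Finset.sum_congr rfl fun i _ => ?_
    rw [← Finset.sum_neg_distrib]
    refine Finset.sum_congr rfl fun j _ => ?_
    simp [reWeight, imWeight]
    ring

end OneBitRadar

/-! ### Moments and characteristic functions of sums of Gaussian signs -/

namespace OneBitRadar

lemma measurable_sign : Measurable Real.sign :=
  Measurable.ite measurableSet_Iio measurable_const
    (Measurable.ite measurableSet_Ioi measurable_const measurable_const)

lemma abs_sign_le_one (x : ℝ) : |Real.sign x| ≤ 1 := by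
  rcases Real.sign_apply_eq x with h | h | h <;> simp [h]

section SignLaw

variable {𝕜 : Type*} [RCLike 𝕜]

lemma integrable_comp_sign {μ : Measure ℝ} [IsFiniteMeasure μ] {g : ℝ → 𝕜} (hg : Continuous g) :
    Integrable (fun x => g (Real.sign x)) μ := by
  refine Integrable.of_bound (hg.measurable.comp measurable_sign).aestronglyMeasurable
    (‖g (-1)‖ + ‖g 0‖ + ‖g 1‖) (ae_of_all _ fun x => ?_)
  have h1 := norm_nonneg (g (-1))
  have h2 := norm_nonneg (g 0)
  have h3 := norm_nonneg (g 1)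
  rcases Real.sign_apply_eq x with h | h | h <;> rw [h] <;> linarith

/-- The sign of a standard normal variable is uniform on `{-1, 1}`. -/
lemma integral_comp_sign_gaussianReal {g : ℝ → 𝕜} (hg : Continuous g) :
    ∫ x, g (Real.sign x) ∂(gaussianReal 0 1) = (g 1 + g (-1)) / 2 := by
  have hint := integrable_comp_sign (μ := gaussianReal 0 1) hg
  have hint' : Integrable (fun x => g (-Real.sign x)) (gaussianReal 0 1) :=
    integrable_comp_sign (g := fun x => g (-x)) (hg.comp continuous_neg)
  -- The Gaussian is symmetric and the sign function is odd.
  have hneg : ∫ x, g (-Real.sign x) ∂(gaussianReal 0 1) =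
      ∫ x, g (Real.sign x) ∂(gaussianReal 0 1) := by
    have hmap : (gaussianReal 0 1).map (fun x => -x) = gaussianReal 0 1 := by
      simpa using gaussianReal_map_neg (μ := 0) (v := 1)
    conv_rhs => rw [← hmap]
    rw [integral_map (f := fun x => g (Real.sign x)) measurable_neg.aemeasurable
      (hg.measurable.comp measurable_sign).aestronglyMeasurable]
    simp [Real.sign_neg]
  -- The integrand is constant off the null set `{0}`, where `Real.sign` takes its third value.
  have hsum : ∫ x, (g (Real.sign x) + g (-Real.sign x)) ∂(gaussianReal 0 1) = g 1 + g (-1) := by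
    have : NullSingletonClass (gaussianReal 0 1) := nullSingletonClass_gaussianReal one_ne_zero
    rw [integral_congr_ae (g := fun _ => g 1 + g (-1)), integral_const]
    · simp
    · filter_upwards [Measure.ae_ne (gaussianReal 0 1) 0] with x hx
      rcases lt_or_gt_of_ne hx with h | h
      · simp [Real.sign_of_neg h, add_comm]
      · simp [Real.sign_of_pos h]
  rw [integral_add hint hint'] at hsum
  rw [hneg] at hsum
  rw [← hsum]
  ring

lemma integral_complexGaussian_sign {f g : ℝ → 𝕜} (hf : Continuous f) (hg : Continuous g) :
    ∫ z, f (Real.sign z.re) * g (Real.sign z.im) ∂complexGaussian =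
      (f 1 + f (-1)) / 2 * ((g 1 + g (-1)) / 2) := by
  rw [complexGaussian, integral_map (φ := fun x : ℝ × ℝ => (⟨x.1, x.2⟩ : ℂ))
    Complex.measurableEquivRealProd.symm.measurable.aemeasurable]
  · rw [integral_prod_mul (fun x => f (Real.sign x)) fun x => g (Real.sign x),
      integral_comp_sign_gaussianReal hf, integral_comp_sign_gaussianReal hg]
  · exact ((hf.measurable.comp (measurable_sign.comp Complex.measurable_re)).mul
      (hg.measurable.comp (measurable_sign.comp Complex.measurable_im))).aestronglyMeasurable

end SignLaw

/-- A linear function of the real and imaginary signs of a complex number. -/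
noncomputable def signForm (a b : ℝ) (z : ℂ) : ℝ := a * Real.sign z.re + b * Real.sign z.im

@[fun_prop]
lemma measurable_signForm (a b : ℝ) : Measurable (signForm a b) :=
  ((measurable_sign.comp Complex.measurable_re).const_mul a).add
    ((measurable_sign.comp Complex.measurable_im).const_mul b)

lemma abs_signForm_le (a b : ℝ) (z : ℂ) : |signForm a b z| ≤ |a| + |b| := by
  refine (abs_add_le _ _).trans ?_
  rw [abs_mul, abs_mul]
  have := abs_sign_le_one z.re
  have := abs_sign_le_one z.im
  gcongr <;> exact mul_le_of_le_one_right (abs_nonneg _) ‹_›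

lemma memLp_signForm_comp {Ω : Type*} [MeasurableSpace Ω] {μ : Measure Ω} [IsFiniteMeasure μ]
    (a b : ℝ) {X : Ω → ℂ} (hX : Measurable X) (p : ℝ≥0∞) :
    MemLp (fun ω => signForm a b (X ω)) p μ :=
  MemLp.of_bound ((measurable_signForm a b).comp hX).aestronglyMeasurable (|a| + |b|) (ae_of_all _ fun ω => abs_signForm_le a b (X ω))

lemma integral_signForm (a b : ℝ) : ∫ z, signForm a b z ∂complexGaussian = 0 := by
  have h1 := integral_complexGaussian_sign (𝕜 := ℝ) (f := fun x => a * x) (g := fun _ => 1)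
    (by fun_prop) (by fun_prop)
  have h2 := integral_complexGaussian_sign (𝕜 := ℝ) (f := fun _ => 1) (g := fun x => b * x)
    (by fun_prop) (by fun_prop)
  have hi (a b : ℝ) : Integrable (signForm a b) complexGaussian :=
    memLp_one_iff_integrable.1 (memLp_signForm_comp a b measurable_id 1)
  have e : signForm a b = fun z => signForm a 0 z + signForm 0 b z := by
    funext z; simp [signForm]
  rw [e, integral_add (hi _ _) (hi _ _)]
  simp only [mul_one, one_mul] at h1 h2
  simp [signForm, h1, h2]

lemma integral_signForm_mul (a b c d : ℝ) :
    ∫ z, signForm a b z * signForm c d z ∂complexGaussian = a * c + b * d := by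
  have h1 := integral_complexGaussian_sign (𝕜 := ℝ) (f := fun x => a * c * x ^ 2)
    (g := fun _ => 1) (by fun_prop) (by fun_prop)
  have h2 := integral_complexGaussian_sign (𝕜 := ℝ) (f := fun x => (a * d + b * c) * x)
    (g := fun x => x) (by fun_prop) (by fun_prop)
  have h3 := integral_complexGaussian_sign (𝕜 := ℝ) (f := fun _ => 1)
    (g := fun x => b * d * x ^ 2) (by fun_prop) (by fun_prop)
  have hi (a b c d : ℝ) : Integrable (fun z => signForm a b z * signForm c d z) complexGaussian :=
    (memLp_signForm_comp a b measurable_id 2).integrable_mul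
      (memLp_signForm_comp c d measurable_id 2)
  have e1 (z : ℂ) : a * c * Real.sign z.re ^ 2 * 1 = signForm a 0 z * signForm c 0 z := by
    simp [signForm]; ring
  have e2 (z : ℂ) : (a * d + b * c) * Real.sign z.re * Real.sign z.im =
      signForm (a * d + b * c) 0 z * signForm 0 1 z := by
    simp [signForm]
  have e3 (z : ℂ) : 1 * (b * d * Real.sign z.im ^ 2) = signForm 0 b z * signForm 0 d z := by
    simp [signForm]; ring
  simp only [e1, e2, e3] at h1 h2 h3
  -- Each piece is a function of one sign times a function of the other, so it integrates by
  -- independence. The squares have mean one and the mixed term has mean zero.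
  have e (z : ℂ) : signForm a b z * signForm c d z = signForm a 0 z * signForm c 0 z +
      signForm (a * d + b * c) 0 z * signForm 0 1 z + signForm 0 b z * signForm 0 d z := by
    simp [signForm]; ring
  simp_rw [e]
  rw [integral_add, integral_add (hi _ _ _ _) (hi _ _ _ _), h1, h2, h3]
  rotate_left
  · exact (hi _ _ _ _).add (hi _ _ _ _)
  · exact hi _ _ _ _
  ring

/-- A fair sign has characteristic function `cos`, and the two signs are independent. -/
lemma integral_exp_signForm (a b : ℝ) :
    ∫ z, Complex.exp (signForm a b z * Complex.I) ∂complexGaussian =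
      (Real.cos a * Real.cos b : ℝ) := by
  have h := integral_complexGaussian_sign (𝕜 := ℂ)
    (f := fun x => Complex.exp ((a * x : ℝ) * Complex.I))
    (g := fun x => Complex.exp ((b * x : ℝ) * Complex.I)) (by fun_prop) (by fun_prop)
  simp_rw [← Complex.exp_add, ← add_mul, ← Complex.ofReal_add] at h
  simp only [signForm, h]
  push_cast
  rw [Complex.cos, Complex.cos]
  simp

variable {m n : ℕ}

lemma measurePreserving_noise_eval (i : Fin m) (j : Fin n) :
    MeasurePreserving (fun N : Fin m → Fin n → ℂ => N i j) (noiseLaw m n) complexGaussian :=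
  (measurePreserving_eval (fun _ : Fin n => complexGaussian) j).comp
    (measurePreserving_eval (fun _ : Fin m => Measure.pi fun _ : Fin n => complexGaussian) i)

lemma iIndepFun_noise :
    iIndepFun (fun (p : Fin m × Fin n) (N : Fin m → Fin n → ℂ) => N p.1 p.2) (noiseLaw m n) := by
  have h := iIndepFun_uncurry_infinitePi' (X := fun (_ : Fin m) (_ : Fin n) (z : ℂ) => z)
    (fun _ _ => complexGaussian) fun _ _ => measurable_id
  simpa [Measure.infinitePi_eq_pi, noiseLaw] using h

/-- A linear function of the real and imaginary signs of the entries of a matrix. -/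
noncomputable def signSum (A B : Fin m → Fin n → ℝ) (N : Fin m → Fin n → ℂ) : ℝ :=
  ∑ p : Fin m × Fin n, signForm (A p.1 p.2) (B p.1 p.2) (N p.1 p.2)

@[fun_prop]
lemma measurable_signSum (A B : Fin m → Fin n → ℝ) : Measurable (signSum A B) := by
  unfold signSum
  fun_prop

lemma memLp_signSum (A B : Fin m → Fin n → ℝ) (p : ℝ≥0∞) :
    MemLp (signSum A B) p (noiseLaw m n) :=
  memLp_finsetSum _ fun _ _ => memLp_signForm_comp _ _ (by fun_prop) p

lemma integral_signSum (A B : Fin m → Fin n → ℝ) :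
    ∫ N, signSum A B N ∂(noiseLaw m n) = 0 := by
  unfold signSum
  rw [integral_finsetSum _ fun p _ => memLp_one_iff_integrable.1
    (memLp_signForm_comp _ _ (by fun_prop) 1)]
  refine Finset.sum_eq_zero fun p _ => ?_
  rw [← integral_signForm (A p.1 p.2) (B p.1 p.2),
    ← (measurePreserving_noise_eval p.1 p.2).map_eq,
    integral_map (Measurable.aemeasurable (by fun_prop)) (by fun_prop)]

lemma covariance_signForm (a b c d : ℝ) (i : Fin m) (j : Fin n) :
    cov[fun N => signForm a b (N i j), fun N => signForm c d (N i j); noiseLaw m n] =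
      a * c + b * d := by
  have h := covariance_map_fun (μ := noiseLaw m n) (Z := fun N => N i j) (X := signForm a b)
    (Y := signForm c d) (by fun_prop) (by fun_prop) (Measurable.aemeasurable (by fun_prop))
  rw [← h, (measurePreserving_noise_eval i j).map_eq,
    covariance_eq_sub (X := signForm a b) (Y := signForm c d)
      (memLp_signForm_comp a b measurable_id 2) (memLp_signForm_comp c d measurable_id 2), integral_signForm, zero_mul, sub_zero]
  exact integral_signForm_mul a b c d

/-- Distinct entries are independent, so only the diagonal of the double sum survives. -/
lemma covariance_signSum (A B C D : Fin m → Fin n → ℝ) :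
    cov[signSum A B, signSum C D; noiseLaw m n] =
      ∑ i, ∑ j, (A i j * C i j + B i j * D i j) := by
  unfold signSum
  rw [covariance_fun_sum_fun_sum (fun _ => memLp_signForm_comp _ _ (by fun_prop) _)
    (fun _ => memLp_signForm_comp _ _ (by fun_prop) _), 
    ← Fintype.sum_prod_type' fun i j => A i j * C i j + B i j * D i j]
  refine Finset.sum_congr rfl fun p _ => ?_
  rw [Finset.sum_eq_single p, covariance_signForm]
  · intro q _ hq
    exact ((iIndepFun_noise.indepFun hq.symm).comp (measurable_signForm _ _)
      (measurable_signForm _ _)).covariance_eq_zero (memLp_signForm_comp _ _ (by fun_prop) _)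
      (memLp_signForm_comp _ _ (by fun_prop) _)
  · simp

lemma integral_signSum_mul (A B C D : Fin m → Fin n → ℝ) :
    ∫ N, signSum A B N * signSum C D N ∂(noiseLaw m n) =
      ∑ i, ∑ j, (A i j * C i j + B i j * D i j) := by
  have h := covariance_eq_sub (memLp_signSum A B 2) (memLp_signSum C D 2)
  rw [covariance_signSum, integral_signSum, zero_mul, sub_zero] at h
  exact h.symm

lemma integral_exp_signSum (A B : Fin m → Fin n → ℝ) :
    ∫ N, Complex.exp (signSum A B N * Complex.I) ∂(noiseLaw m n) =
      ((∏ p : (Fin m × Fin n), (Real.cos (A p.1 p.2) * Real.cos (B p.1 p.2)) : ℝ) : ℂ) := by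
  unfold signSum
  simp_rw [Complex.ofReal_sum, Finset.sum_mul, Complex.exp_sum]
  have h := iIndepFun.integral_fun_prod_comp (𝕜 := ℂ)
    (f := fun p z => Complex.exp (signForm (A p.1 p.2) (B p.1 p.2) z * Complex.I))
    (iIndepFun_noise (m := m) (n := n)) (fun p => Measurable.aemeasurable (by fun_prop))
    (fun p => by fun_prop)
  rw [h, Complex.ofReal_prod]
  refine Finset.prod_congr rfl fun p _ => ?_
  rw [← integral_exp_signForm,
    ← (measurePreserving_noise_eval p.1 p.2).map_eq,
    integral_map (Measurable.aemeasurable (by fun_prop)) (by fun_prop)]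

end OneBitRadar

/-! ### The chi-squared law with two degrees of freedom -/

namespace OneBitRadar

section LimitLaw

open Complex

/-- The factor `exp (i t x²)` merges with the density into a Gaussian integral with complex
parameter `1 / 2 - i t`, whose real part is positive. -/
lemma charFun_map_sq_gaussianReal (t : ℝ) :
    ∫ x : ℝ, cexp (t * (x ^ 2 : ℝ) * I) ∂(gaussianReal 0 1) =
      (1 / Real.sqrt (2 * Real.pi) : ℝ) * (Real.pi / (1 / 2 - t * I)) ^ (1 / 2 : ℂ) := by
  rw [integral_gaussianReal_eq_integral_smul one_ne_zero,
    ← integral_gaussian_complex (b := 1 / 2 - t * I) (by simp), ← integral_const_mul]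
  congr with x
  simp only [gaussianPDFReal, NNReal.coe_one, mul_one, sub_zero, real_smul]
  push_cast
  rw [one_div, mul_assoc, ← Complex.exp_add]
  congr 2
  ring

lemma charFun_chiSquared_two (t : ℝ) :
    charFun (chiSquared 2) t = (1 / 2) / (1 / 2 - t * I) := by
  have hne : (1 / 2 - t * I : ℂ) ≠ 0 := fun h => by simpa using congrArg Complex.re h
  rw [charFun_apply_real, chiSquared, integral_map
    (Measurable.aemeasurable (by fun_prop)) (by fun_prop)]
  simp only [Complex.ofReal_sum, Finset.mul_sum, Finset.sum_mul, Complex.exp_sum]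
  rw [integral_fintype_prod_eq_prod (f := fun (_ : Fin 2) (x : ℝ) => cexp (t * (x ^ 2 : ℝ) * I))]
  simp only [charFun_map_sq_gaussianReal, Finset.prod_const, Finset.card_univ, Fintype.card_fin,
    mul_pow]
  -- Two degrees of freedom square the half power, so the complex square root disappears.
  rw [← Complex.cpow_nat_mul, ← Complex.ofReal_pow, div_pow, Real.sq_sqrt (by positivity)]
  have : (Real.pi : ℂ) ≠ 0 := by simp [Real.pi_ne_zero]
  norm_num
  field_simp

lemma charFun_expMeasure {r : ℝ} (hr : 0 < r) (t : ℝ) :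
    charFun (expMeasure r) t = r / (r - t * I) := by
  have hne : (r - t * I : ℂ) ≠ 0 := fun h => hr.ne' (by simpa using congrArg Complex.re h)
  have hI := integral_exp_mul_complex_Ioi (a := -(r - t * I)) (by simpa using hr) 0
  rw [charFun_apply_real]
  change ∫ x, _ ∂(volume.withDensity fun x => ENNReal.ofReal (exponentialPDFReal r x)) = _
  rw [integral_withDensity_eq_integral_toReal_smul
    (measurable_exponentialPDFReal r).ennreal_ofReal (by simp)]
  have hf (x : ℝ) : (ENNReal.ofReal (exponentialPDFReal r x)).toReal =
      if 0 ≤ x then r * Real.exp (-(r * x)) else 0 := by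
    rw [← exponentialPDF, exponentialPDF_eq, ENNReal.toReal_ofReal]
    split_ifs <;> positivity
  simp_rw [hf]
  rw [← setIntegral_eq_integral_of_forall_compl_eq_zero (s := Set.Ici 0)
    fun x hx => by rw [if_neg (by simpa using hx), zero_smul], integral_Ici_eq_integral_Ioi,
    setIntegral_congr_fun (g := fun x : ℝ => r * cexp (-(r - t * I) * x)) measurableSet_Ioi
    fun x hx => ?_, integral_const_mul, hI]
  · rw [Complex.ofReal_zero, mul_zero, Complex.exp_zero, neg_div_neg_eq, mul_one_div]
  · simp only [if_pos (Set.mem_Ioi.1 hx).le, real_smul]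
    push_cast
    rw [mul_assoc, ← Complex.exp_add]
    congr 2
    ring

end LimitLaw

lemma chiSquared_two_eq_expMeasure : chiSquared 2 = expMeasure (1 / 2) := by
  have := isProbabilityMeasure_expMeasure (r := 1 / 2) (by norm_num)
  refine Measure.ext_of_charFun (funext fun t => ?_)
  rw [charFun_chiSquared_two, charFun_expMeasure (by norm_num)]
  norm_num

lemma chiSquared_two_real_Ioi {γ : ℝ} (hγ : 0 ≤ γ) :
    (chiSquared 2).real (Set.Ioi γ) = Real.exp (-γ / 2) := by
  rw [← Set.compl_Iic, probReal_compl_eq_one_sub measurableSet_Iic, ← cdf_eq_real,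
    chiSquared_two_eq_expMeasure, cdf_expMeasure_eq (by norm_num), if_pos hγ, sub_sub_cancel]
  congr 1
  ring

lemma integrable_sq_gaussianReal : Integrable (fun x : ℝ => x ^ 2) (gaussianReal 0 1) :=
  (memLp_id_gaussianReal' 2 (by simp)).integrable_sq

lemma integral_sq_gaussianReal : ∫ x : ℝ, x ^ 2 ∂(gaussianReal 0 1) = 1 := by
  have h := variance_id_gaussianReal (μ := 0) (v := 1)
  rwa [variance_of_integral_eq_zero aemeasurable_id (by simp), NNReal.coe_one] at h

lemma aemeasurable_sum_sq (f : ℕ) :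
    AEMeasurable (fun x : Fin f → ℝ => ∑ k, x k ^ 2) (Measure.pi fun _ => gaussianReal 0 1) :=
  Measurable.aemeasurable (by fun_prop)

lemma integrable_sq_eval {f : ℕ} (k : Fin f) :
    Integrable (fun x : Fin f → ℝ => x k ^ 2) (Measure.pi fun _ => gaussianReal 0 1) :=
  integrable_comp_eval (μ := fun _ : Fin f => gaussianReal 0 1) (i := k)
    (f := fun x : ℝ => x ^ 2) integrable_sq_gaussianReal

lemma integrable_id_chiSquared (f : ℕ) : Integrable id (chiSquared f) := by
  rw [chiSquared, integrable_map_measure (by fun_prop) (aemeasurable_sum_sq f)]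
  exact integrable_finsetSum Finset.univ fun k _ => integrable_sq_eval k

lemma integral_id_chiSquared (f : ℕ) : ∫ x, x ∂(chiSquared f) = f := by
  rw [chiSquared, integral_map (aemeasurable_sum_sq f) (by fun_prop),
    integral_finsetSum _ fun k _ => integrable_sq_eval k]
  have (k : Fin f) : ∫ x : Fin f → ℝ, x k ^ 2 ∂(Measure.pi fun _ => gaussianReal 0 1) = 1 := by
    rw [integral_comp_eval (μ := fun _ : Fin f => gaussianReal 0 1) (i := k)
      (f := fun x : ℝ => x ^ 2)    integrable_sq_gaussianReal.aestronglyMeasurable, integral_sq_gaussianReal]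
  simp [this]

lemma multivariateGaussian_map_sq_add_sq :
    (multivariateGaussian (0 : EuclideanSpace ℝ (Fin 2)) (1 : Matrix (Fin 2) (Fin 2) ℝ)).map
      (fun x => x 0 ^ 2 + x 1 ^ 2) = chiSquared 2 := by
  rw [multivariateGaussian_zero_one, ← map_pi_eq_stdGaussian,
    Measure.map_map (by fun_prop) (by fun_prop), chiSquared]
  congr 1 with x
  simp [Fin.sum_univ_two]

end OneBitRadar

/-! ### Comparing products of cosines with a Gaussian -/

namespace OneBitRadar

section CentralLimit

/-- Both functions equal `1 - x² / 2` up to a small multiple of `x⁴`. -/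
lemma abs_cos_sub_exp_le {x : ℝ} (hx : |x| ≤ 1) :
    |Real.cos x - Real.exp (-(x ^ 2 / 2))| ≤ x ^ 4 := by
  have hx2 : x ^ 2 ≤ 1 := (sq_le_one_iff_abs_le_one x).2 hx
  have h1 := Real.cos_bound hx
  have h2 := Real.abs_exp_sub_one_sub_id_le (x := -(x ^ 2 / 2))
    (by rw [abs_neg, abs_of_nonneg (by positivity)]; linarith)
  rw [show |x| ^ 4 = x ^ 4 from Even.pow_abs (by decide) x] at h1
  have h4 : 0 ≤ x ^ 4 := by positivity
  rw [abs_le] at *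
  constructor <;> nlinarith

lemma abs_cos_mul_cos_sub_exp_le {x y : ℝ} (hx : |x| ≤ 1) (hy : |y| ≤ 1) :
    |Real.cos x * Real.cos y - Real.exp (-((x ^ 2 + y ^ 2) / 2))| ≤ (x ^ 2 + y ^ 2) ^ 2 := by
  have h1 := abs_cos_sub_exp_le hx
  have h2 := abs_cos_sub_exp_le hy
  have e : Real.exp (-((x ^ 2 + y ^ 2) / 2)) =
      Real.exp (-(x ^ 2 / 2)) * Real.exp (-(y ^ 2 / 2)) := by
    rw [← Real.exp_add]
    congr 1
    ring
  have h3 : Real.exp (-(x ^ 2 / 2)) ≤ 1 := Real.exp_le_one_iff.2 (by linarith [sq_nonneg x])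
  calc |Real.cos x * Real.cos y - Real.exp (-((x ^ 2 + y ^ 2) / 2))|
      = |(Real.cos x - Real.exp (-(x ^ 2 / 2))) * Real.cos y +
          Real.exp (-(x ^ 2 / 2)) * (Real.cos y - Real.exp (-(y ^ 2 / 2)))| := by
        rw [e]
        ring_nf
    _ ≤ x ^ 4 * 1 + 1 * y ^ 4 := by
        refine (abs_add_le _ _).trans ?_
        rw [abs_mul, abs_mul, abs_of_pos (Real.exp_pos _)]
        gcongr
        exact Real.abs_cos_le_one y
    _ ≤ (x ^ 2 + y ^ 2) ^ 2 := by nlinarith [mul_nonneg (sq_nonneg x) (sq_nonneg y)]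

/-- Telescoping: factors are exchanged one at a time, the others being bounded by one. -/
lemma abs_prod_sub_prod_le {ι : Type*} (s : Finset ι) (f g : ι → ℝ)
    (hf : ∀ i ∈ s, |f i| ≤ 1) (hg : ∀ i ∈ s, |g i| ≤ 1) :
    |∏ i ∈ s, f i - ∏ i ∈ s, g i| ≤ ∑ i ∈ s, |f i - g i| := by
  classical
  induction s using Finset.induction_on with
  | empty => simp
  | insert a s ha ih =>
    rw [Finset.prod_insert ha, Finset.prod_insert ha, Finset.sum_insert ha]
    have hf' := fun i hi => hf i (Finset.mem_insert_of_mem hi)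
    have hg' := fun i hi => hg i (Finset.mem_insert_of_mem hi)
    have hpf : |∏ i ∈ s, f i| ≤ 1 := by
      rw [Finset.abs_prod]
      exact Finset.prod_le_one (fun _ _ => abs_nonneg _) hf'
    calc |f a * ∏ i ∈ s, f i - g a * ∏ i ∈ s, g i|
        = |(f a - g a) * ∏ i ∈ s, f i + g a * (∏ i ∈ s, f i - ∏ i ∈ s, g i)| := by ring_nf
      _ ≤ |f a - g a| * 1 + 1 * ∑ i ∈ s, |f i - g i| := by
        refine (abs_add_le _ _).trans ?_
        rw [abs_mul, abs_mul]
        gcongr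
        · exact hg a (Finset.mem_insert_self a s)
        · exact ih hf' hg'
      _ = _ := by ring

/-- With `q = f² + g²`, each factor contributes an error of at most `q² ≤ δ q`; the condition `δ ≤
1` keeps the arguments where the Taylor bounds hold. -/
lemma abs_prod_cos_mul_cos_sub_exp_le {ι : Type*} (s : Finset ι) (f g : ι → ℝ) {δ : ℝ}
    (hδ : δ ≤ 1) (h : ∀ i ∈ s, f i ^ 2 + g i ^ 2 ≤ δ) :
    |∏ i ∈ s, (Real.cos (f i) * Real.cos (g i)) -
      Real.exp (-((∑ i ∈ s, (f i ^ 2 + g i ^ 2)) / 2))| ≤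
      δ * ∑ i ∈ s, (f i ^ 2 + g i ^ 2) := by
  rw [Finset.sum_div, ← Finset.sum_neg_distrib, Real.exp_sum, Finset.mul_sum]
  refine (abs_prod_sub_prod_le s _ _ (fun i _ => ?_) fun i _ => ?_).trans
    (Finset.sum_le_sum fun i hi => ?_)
  · rw [abs_mul]
    exact mul_le_one₀ (Real.abs_cos_le_one _) (abs_nonneg _) (Real.abs_cos_le_one _)
  · rw [abs_of_pos (Real.exp_pos _), Real.exp_le_one_iff]
    have := sq_nonneg (f i)
    have := sq_nonneg (g i)
    linarith
  · have hi := h i hi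
    have hf := sq_nonneg (f i)
    have hg := sq_nonneg (g i)
    refine (abs_cos_mul_cos_sub_exp_le ((sq_le_one_iff_abs_le_one _).1 (by linarith))
      ((sq_le_one_iff_abs_le_one _).1 (by linarith))).trans ?_
    rw [sq]
    gcongr

end CentralLimit

/-! ### Rao's statistic and the vector `w` under the null hypothesis -/

variable {m n : ℕ}

/-- The coefficients of the real parts of the data in the coordinates of `w`. -/
noncomputable def wRe (Z : Matrix (Fin m) (Fin n) ℂ) (k : Fin 2) (i : Fin m) (j : Fin n) : ℝ :=
  reWeight k (Z i j) / Real.sqrt ((m : ℝ) * n)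

/-- The coefficients of the imaginary parts of the data in the coordinates of `w`. -/
noncomputable def wIm (Z : Matrix (Fin m) (Fin n) ℂ) (k : Fin 2) (i : Fin m) (j : Fin n) : ℝ :=
  imWeight k (Z i j) / Real.sqrt ((m : ℝ) * n)

lemma corr_quantize (Z : Matrix (Fin m) (Fin n) ℂ) (N : Fin m → Fin n → ℂ) (k : Fin 2) :
    corr k Z (quantize (Matrix.of N)) =
      signSum (fun i j => reWeight k (Z i j)) (fun i j => imWeight k (Z i j)) N := by
  rw [signSum, Fintype.sum_prod_type]
  rfl

lemma wVec_quantize (Z : Matrix (Fin m) (Fin n) ℂ) (N : Fin m → Fin n → ℂ) (k : Fin 2) :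
    wVec Z (quantize (Matrix.of N)) k = signSum (wRe Z k) (wIm Z k) N := by
  rw [wVec_apply, corr_quantize, signSum, signSum, Finset.sum_div]
  refine Finset.sum_congr rfl fun p _ => ?_
  simp only [signForm, wRe, wIm]
  ring

lemma weight_mul_add (k l : Fin 2) (z : ℂ) :
    reWeight k z * reWeight l z + imWeight k z * imWeight l z =
      (1 : Matrix (Fin 2) (Fin 2) ℝ) k l * ‖z‖ ^ 2 := by
  rw [Complex.sq_norm, Complex.normSq_apply]
  fin_cases k <;> fin_cases l <;> simp [reWeight, imWeight] <;> ring

lemma sum_normSq_of_trace {Z : Matrix (Fin m) (Fin n) ℂ}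
    (h : (Z * Zᴴ).trace = (m : ℂ) * (n : ℂ)) : ∑ i, ∑ j, ‖Z i j‖ ^ 2 = (m : ℝ) * n := by
  simp only [Matrix.trace, Matrix.diag_apply, Matrix.mul_apply, Matrix.conjTranspose_apply,
    RCLike.star_def, Complex.mul_conj, Complex.normSq_eq_norm_sq] at h
  exact_mod_cast h

lemma fisherInfo_zero (Z : Matrix (Fin m) (Fin n) ℂ) :
    fisherInfo Z 0 = ((2 / Real.sqrt (2 * Real.pi)) ^ 2 * ∑ i, ∑ j, ‖Z i j‖ ^ 2) •
      (1 : Matrix (Fin 2) (Fin 2) ℝ) := by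
  ext k l
  simp only [fisherInfo, zero_smul, zero_add, score_zero_apply, corr_quantize, Matrix.of_apply,
    Matrix.smul_apply, smul_eq_mul, mul_mul_mul_comm _ (signSum _ _ _)]
  rw [integral_const_mul, integral_signSum_mul]
  simp_rw [weight_mul_add, ← Finset.mul_sum]
  ring

lemma raoStat_eq (Z Y : Matrix (Fin m) (Fin n) ℂ) :
    raoStat Z Y = (corr 0 Z Y ^ 2 + corr 1 Z Y ^ 2) / ∑ i, ∑ j, ‖Z i j‖ ^ 2 := by
  -- For `a = 0` both sides vanish by the conventions for inverses, so `Z = 0` needs no exclusion.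
  have hinv (a : ℝ) : (a • (1 : Matrix (Fin 2) (Fin 2) ℝ))⁻¹ = a⁻¹ • 1 := by
    rcases eq_or_ne a 0 with rfl | ha
    · simp
    · exact Matrix.inv_eq_right_inv (by simp [smul_smul, ha])
  have hc : 2 / Real.sqrt (2 * Real.pi) ≠ 0 := by positivity
  simp only [raoStat, fisherInfo_zero, hinv, Matrix.smul_mulVec, Matrix.one_mulVec, dotProduct,
    Pi.smul_apply, Fin.sum_univ_two, score_zero_apply, smul_eq_mul, mul_inv]
  field_simp

lemma uW_zero (Z : Matrix (Fin m) (Fin n) ℂ) : uW Z 0 = 0 := by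
  ext k
  fin_cases k <;> simp [uW, cCoef, dCoef, Q_zero]

lemma sigmaW_zero (Z : Matrix (Fin m) (Fin n) ℂ) : sigmaW Z 0 = 1 := by
  ext k l
  fin_cases k <;> fin_cases l <;> simp [sigmaW, sigma12, cCoef, dCoef, Q_zero]

lemma sum_wRe_wIm {Z : Matrix (Fin m) (Fin n) ℂ} (hmn : (m : ℝ) * n ≠ 0)
    (h : ∑ i, ∑ j, ‖Z i j‖ ^ 2 = (m : ℝ) * n) (k l : Fin 2) :
    ∑ i, ∑ j, (wRe Z k i j * wRe Z l i j + wIm Z k i j * wIm Z l i j) =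
      (1 : Matrix (Fin 2) (Fin 2) ℝ) k l := by
  have hs : Real.sqrt ((m : ℝ) * n) * Real.sqrt ((m : ℝ) * n) = (m : ℝ) * n :=
    Real.mul_self_sqrt (by positivity)
  simp_rw [wRe, wIm, div_mul_div_comm, hs, ← add_div, weight_mul_add, ← Finset.sum_div,
    ← Finset.mul_sum, h]
  exact mul_div_cancel_right₀ _ hmn

/-- Orthogonality kills the cross term in `s * t`. This computes the squared weight of one sample in
`⟨w, (s, t)⟩`. -/
lemma sq_add_sq_wRe_wIm (Z : Matrix (Fin m) (Fin n) ℂ) (s t : ℝ) (i : Fin m) (j : Fin n) :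
    (s * wRe Z 0 i j + t * wRe Z 1 i j) ^ 2 + (s * wIm Z 0 i j + t * wIm Z 1 i j) ^ 2 =
      (s ^ 2 + t ^ 2) * (‖Z i j‖ ^ 2 / ((m : ℝ) * n)) := by
  have hs : Real.sqrt ((m : ℝ) * n) ^ 2 = (m : ℝ) * n := Real.sq_sqrt (by positivity)
  rw [Complex.sq_norm, Complex.normSq_apply, ← hs]
  simp [wRe, wIm, reWeight, imWeight]
  ring

lemma inner_wVec_quantize (Z : Matrix (Fin m) (Fin n) ℂ) (N : Fin m → Fin n → ℂ)
    (t : EuclideanSpace ℝ (Fin 2)) :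
    inner ℝ (wVec Z (quantize (Matrix.of N))) t =
      signSum (fun i j => t 0 * wRe Z 0 i j + t 1 * wRe Z 1 i j)
        (fun i j => t 0 * wIm Z 0 i j + t 1 * wIm Z 1 i j) N := by
  rw [PiLp.inner_apply, Fin.sum_univ_two, wVec_quantize, wVec_quantize]
  simp only [signSum, signForm, RCLike.inner_apply, conj_trivial, Finset.mul_sum,
    ← Finset.sum_add_distrib]
  refine Finset.sum_congr rfl fun p _ => ?_
  ring

lemma measurable_wVec_quantize (Z : Matrix (Fin m) (Fin n) ℂ) :
    Measurable fun N : Fin m → Fin n → ℂ => wVec Z (quantize (Matrix.of N)) := by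
  have e : (fun N : Fin m → Fin n → ℂ => wVec Z (quantize (Matrix.of N))) =
      fun N => WithLp.toLp 2 fun k => signSum (wRe Z k) (wIm Z k) N := by
    funext N
    ext k
    exact wVec_quantize Z N k
  rw [e]
  fun_prop

lemma charFun_wVec_quantize (Z : Matrix (Fin m) (Fin n) ℂ) (t : EuclideanSpace ℝ (Fin 2)) :
    charFun ((noiseLaw m n).map fun N => wVec Z (quantize (Matrix.of N))) t =
      ((∏ p : Fin m × Fin n,
        (Real.cos (t 0 * wRe Z 0 p.1 p.2 + t 1 * wRe Z 1 p.1 p.2) *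
          Real.cos (t 0 * wIm Z 0 p.1 p.2 + t 1 * wIm Z 1 p.1 p.2)) : ℝ) : ℂ) := by
  rw [charFun_apply, integral_map (measurable_wVec_quantize Z).aemeasurable (by fun_prop)]
  simp_rw [inner_wVec_quantize]
  exact integral_exp_signSum _ _

lemma tendsto_charFun_wVec_quantize (hm : 0 < m) (Z : ∀ n : ℕ, Matrix (Fin m) (Fin n) ℂ)
    (hnorm : ∀ n, ∑ i, ∑ j, ‖Z n i j‖ ^ 2 = (m : ℝ) * n)
    (hneg : ∀ ε : ℝ, 0 < ε → ∀ᶠ n : ℕ in atTop, ∀ i j, ‖Z n i j‖ ^ 2 ≤ ε * (n : ℝ))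
    (t : EuclideanSpace ℝ (Fin 2)) :
    Tendsto (fun n => charFun ((noiseLaw m n).map fun N =>
      wVec (Z n) (quantize (Matrix.of N))) t) atTop
      (𝓝 (charFun (stdGaussian (EuclideanSpace ℝ (Fin 2))) t)) := by
  set s : ℝ := t 0 ^ 2 + t 1 ^ 2 with hs
  have hs0 : 0 ≤ s := by positivity
  have hlim : charFun (stdGaussian (EuclideanSpace ℝ (Fin 2))) t =
      ((Real.exp (-(s / 2)) : ℝ) : ℂ) := by
    rw [charFun_stdGaussian, ← Complex.ofReal_pow, EuclideanSpace.real_norm_sq_eq,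
      Fin.sum_univ_two, ← hs]
    push_cast
    ring_nf
  simp_rw [charFun_wVec_quantize, hlim]
  refine (Complex.continuous_ofReal.tendsto _).comp ?_
  rw [Metric.tendsto_atTop']
  intro ε hε
  -- The final error is `δ * s`, which this choice keeps below `ε`. Using `s + 1` avoids division by
  -- zero at `t = 0`.
  set δ : ℝ := min 1 (ε / (2 * (s + 1))) with hδ
  have hδ0 : 0 < δ := by positivity
  obtain ⟨n₀, hn₀⟩ := eventually_atTop.1 (hneg (δ / (s + 1)) (by positivity))
  refine ⟨n₀, fun n hn => ?_⟩
  have hmR : (1 : ℝ) ≤ m := by exact_mod_cast hm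
  -- The strict form `n > n₀` of the limit criterion excludes `n = 0`.
  have hnR : (0 : ℝ) < n := by exact_mod_cast (Nat.zero_le _).trans_lt hn
  have hsum : ∑ p : Fin m × Fin n,
      ((t 0 * wRe (Z n) 0 p.1 p.2 + t 1 * wRe (Z n) 1 p.1 p.2) ^ 2 +
        (t 0 * wIm (Z n) 0 p.1 p.2 + t 1 * wIm (Z n) 1 p.1 p.2) ^ 2) = s := by
    simp_rw [sq_add_sq_wRe_wIm]
    rw [← Finset.mul_sum, ← Finset.sum_div, Fintype.sum_prod_type, hnorm n,
      div_self (by positivity), mul_one]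
  have hle : ∀ p ∈ (Finset.univ : Finset (Fin m × Fin n)),
      (t 0 * wRe (Z n) 0 p.1 p.2 + t 1 * wRe (Z n) 1 p.1 p.2) ^ 2 +
        (t 0 * wIm (Z n) 0 p.1 p.2 + t 1 * wIm (Z n) 1 p.1 p.2) ^ 2 ≤ δ := by
    intro p _
    rw [sq_add_sq_wRe_wIm, ← hs]
    calc s * (‖Z n p.1 p.2‖ ^ 2 / ((m : ℝ) * n))
        ≤ (s + 1) * (δ / (s + 1) * n / (1 * n)) := by
          gcongr
          · linarith
          · exact hn₀ n hn.le p.1 p.2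
      _ = δ := by field_simp
  have h := abs_prod_cos_mul_cos_sub_exp_le Finset.univ
    (fun p : Fin m × Fin n => t 0 * wRe (Z n) 0 p.1 p.2 + t 1 * wRe (Z n) 1 p.1 p.2)
    (fun p => t 0 * wIm (Z n) 0 p.1 p.2 + t 1 * wIm (Z n) 1 p.1 p.2) (min_le_left _ _) hle
  rw [hsum] at h
  rw [Real.dist_eq]
  refine h.trans_lt ?_
  calc δ * s ≤ ε / (2 * (s + 1)) * (s + 1) := by
        gcongr
        · exact min_le_right _ _
        · linarith
    _ = ε / 2 := by field_simp
    _ < ε := by linarith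

lemma tendstoInDistribution_wVec (hm : 0 < m) (Z : ∀ n : ℕ, Matrix (Fin m) (Fin n) ℂ)
    (hnorm : ∀ n, ∑ i, ∑ j, ‖Z n i j‖ ^ 2 = (m : ℝ) * n)
    (hneg : ∀ ε : ℝ, 0 < ε → ∀ᶠ n : ℕ in atTop, ∀ i j, ‖Z n i j‖ ^ 2 ≤ ε * (n : ℝ))
    {Ω : ℕ → Type*} [∀ n, MeasurableSpace (Ω n)]
    (P : ∀ n, Measure (Ω n)) [∀ n, IsProbabilityMeasure (P n)]
    (N : ∀ n, Ω n → Fin m → Fin n → ℂ) (hN : ∀ n, HasLaw (N n) (noiseLaw m n) (P n)) :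
    TendstoInDistribution (fun n ω => wVec (Z n) (quantize (Matrix.of (N n ω)))) atTop id P
      (multivariateGaussian (0 : EuclideanSpace ℝ (Fin 2)) (1 : Matrix (Fin 2) (Fin 2) ℝ)) where
  forall_aemeasurable n := (measurable_wVec_quantize (Z n)).comp_aemeasurable (hN n).aemeasurable
  tendsto := by
    refine ProbabilityMeasure.tendsto_iff_tendsto_charFun.2 fun t => ?_
    -- The law of `w` depends only on the law of the noise, so the varying spaces `Ω n` drop out.
    have hmap (n : ℕ) : (P n).map (fun ω => wVec (Z n) (quantize (Matrix.of (N n ω)))) =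
        (noiseLaw m n).map fun N => wVec (Z n) (quantize (Matrix.of N)) := by
      rw [← (hN n).map_eq, AEMeasurable.map_map_of_aemeasurable
        (measurable_wVec_quantize (Z n)).aemeasurable (hN n).aemeasurable]
      rfl
    simp only [ProbabilityMeasure.coe_mk, hmap, Measure.map_id, multivariateGaussian_zero_one]
    exact tendsto_charFun_wVec_quantize hm Z hnorm hneg t

lemma chiSquared_two_singleton (γ : ℝ) : chiSquared 2 {γ} = 0 := by
  rw [chiSquared_two_eq_expMeasure]
  exact withDensity_absolutelyContinuous _ _ (measure_singleton γ)

lemma raoStat_eq_wVec {Z : Matrix (Fin m) (Fin n) ℂ}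
    (h : ∑ i, ∑ j, ‖Z i j‖ ^ 2 = (m : ℝ) * n) (Y : Matrix (Fin m) (Fin n) ℂ) :
    raoStat Z Y = wVec Z Y 0 ^ 2 + wVec Z Y 1 ^ 2 := by
  rw [raoStat_eq, h, wVec_apply, wVec_apply, div_pow, div_pow, Real.sq_sqrt (by positivity),
    add_div]

lemma tendstoInDistribution_sq_add_sq {Ω : ℕ → Type*} [∀ n, MeasurableSpace (Ω n)]
    {P : ∀ n, Measure (Ω n)} [∀ n, IsProbabilityMeasure (P n)]
    {w : ∀ n, Ω n → EuclideanSpace ℝ (Fin 2)}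
    (hw : TendstoInDistribution w atTop id P
      (multivariateGaussian (0 : EuclideanSpace ℝ (Fin 2)) (1 : Matrix (Fin 2) (Fin 2) ℝ))) :
    TendstoInDistribution (fun n ω => w n ω 0 ^ 2 + w n ω 1 ^ 2) atTop id P (chiSquared 2) := by
  have h := hw.continuous_comp (g := fun x : EuclideanSpace ℝ (Fin 2) => x 0 ^ 2 + x 1 ^ 2)
    (by fun_prop)
  refine ⟨h.forall_aemeasurable, aemeasurable_id, ?_⟩
  convert! h.tendsto using 2
  refine congrArg 𝓝 (Subtype.ext ?_)
  simp only [Measure.map_id, Function.comp_id]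
  exact multivariateGaussian_map_sq_add_sq.symm

lemma tendsto_measureReal_lt_of_chiSquared {Ω : ℕ → Type*} [∀ n, MeasurableSpace (Ω n)]
    {P : ∀ n, Measure (Ω n)} [∀ n, IsProbabilityMeasure (P n)] {T : ∀ n, Ω n → ℝ}
    (hT : TendstoInDistribution T atTop id P (chiSquared 2)) {γ : ℝ} (hγ : 0 ≤ γ) :
    Tendsto (fun n => (P n).real {ω | γ < T n ω}) atTop (𝓝 (Real.exp (-γ / 2))) := by
  -- Portmanteau: the frontier of the half-line is `{γ}`, which is null for the limit law.
  have h := ProbabilityMeasure.tendsto_measure_of_null_frontier_of_tendsto' hT.tendsto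
    (E := Set.Ioi γ) (by simp [chiSquared_two_singleton])
  simp only [ProbabilityMeasure.coe_mk, Measure.map_id] at h
  have h' := (ENNReal.tendsto_toReal (measure_ne_top _ _)).comp h
  rw [← chiSquared_two_real_Ioi hγ]
  refine h'.congr fun n => ?_
  simp only [Function.comp_apply]
  rw [Measure.map_apply_of_aemeasurable (hT.forall_aemeasurable n) measurableSet_Ioi]
  rfl

end OneBitRadar


/-! ### Assembly of the main theorem -/

theorem mainTheorem4 {m p : ℕ} (hm : 0 < m)
    (aR : Fin m → ℂ) (aT : Fin p → ℂ) (S : ∀ n : ℕ, Matrix (Fin p) (Fin n) ℂ)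
    (Z : ∀ n : ℕ, Matrix (Fin m) (Fin n) ℂ)
    (hZ : ∀ n, Z n = OneBitRadar.response aR aT (S n))
    (hnorm : ∀ n, (Z n * (Z n)ᴴ).trace = (m : ℂ) * (n : ℂ))
    (hneg : ∀ ε : ℝ, 0 < ε → ∀ᶠ n : ℕ in atTop, ∀ i j, ‖Z n i j‖ ^ 2 ≤ ε * (n : ℝ))
    {Ω : ℕ → Type*} [∀ n, MeasurableSpace (Ω n)]
    (P : ∀ n, Measure (Ω n)) [∀ n, IsProbabilityMeasure (P n)]
    (N : ∀ n, Ω n → Fin m → Fin n → ℂ)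
    (hN : ∀ n, HasLaw (N n) (OneBitRadar.noiseLaw m n) (P n))
    (Y : ∀ n, Ω n → Matrix (Fin m) (Fin n) ℂ)
    (hY : ∀ n ω, Y n ω = OneBitRadar.quantize (Matrix.of (N n ω)))
    (w : ∀ n, Ω n → EuclideanSpace ℝ (Fin 2))
    (hw : ∀ n ω, w n ω = OneBitRadar.wVec (Z n) (Y n ω))
    (T : ∀ n, Ω n → ℝ) (hT : ∀ n ω, T n ω = OneBitRadar.raoStat (Z n) (Y n ω)) :
    -- closed form of the statistic
    (∀ n, 0 < n → ∀ ω,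
      T n ω = ‖(Y n ω * (Z n)ᴴ).trace‖ ^ 2 / ((m : ℝ) * n) ∧
      T n ω = w n ω 0 ^ 2 + w n ω 1 ^ 2) ∧
    -- mean and covariance under the null hypothesis
    (∀ n, 0 < n →
      OneBitRadar.uW (Z n) 0 = 0 ∧ OneBitRadar.sigmaW (Z n) 0 = 1 ∧
      (∀ k, MemLp (fun ω => w n ω k) 2 (P n) ∧
        ∫ ω, w n ω k ∂(P n) = OneBitRadar.uW (Z n) 0 k) ∧
      ∀ k l, covariance (fun ω => w n ω k) (fun ω => w n ω l) (P n) =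
        OneBitRadar.sigmaW (Z n) 0 k l) ∧
    -- limit laws
    TendstoInDistribution w atTop id P
      (multivariateGaussian (0 : EuclideanSpace ℝ (Fin 2)) (1 : Matrix (Fin 2) (Fin 2) ℝ)) ∧
    TendstoInDistribution T atTop id P (OneBitRadar.chiSquared 2) ∧
    OneBitRadar.chiSquared 2 = expMeasure (1 / 2) ∧
    Integrable id (OneBitRadar.chiSquared 2) ∧ ∫ x, x ∂(OneBitRadar.chiSquared 2) = 2 ∧
    -- probability of false alarm
    (∀ γ : ℝ, 0 ≤ γ →
      (OneBitRadar.chiSquared 2).real (Set.Ioi γ) = Real.exp (-γ / 2) ∧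
      Tendsto (fun n => (P n).real {ω | γ < T n ω}) atTop (𝓝 (Real.exp (-γ / 2)))) ∧
    -- threshold
    (∀ α : ℝ, 0 < α → α ≤ 1 →
      0 ≤ -2 * Real.log α ∧
      (∀ γ : ℝ, Real.exp (-γ / 2) = α ↔ γ = -2 * Real.log α) ∧
      Tendsto (fun n => (P n).real {ω | -2 * Real.log α < T n ω}) atTop (𝓝 α)) := by 
  have hS (n : ℕ) := OneBitRadar.sum_normSq_of_trace (hnorm n)
  have hwN (n : ℕ) (ω : Ω n) :
      w n ω = OneBitRadar.wVec (Z n) (OneBitRadar.quantize (Matrix.of (N n ω))) := by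
    rw [hw, hY]
  have hTw (n : ℕ) (ω : Ω n) : T n ω = w n ω 0 ^ 2 + w n ω 1 ^ 2 := by
    rw [hT, hw, OneBitRadar.raoStat_eq_wVec (hS n)]
  have hwlim : TendstoInDistribution w atTop id P
      (multivariateGaussian (0 : EuclideanSpace ℝ (Fin 2)) (1 : Matrix (Fin 2) (Fin 2) ℝ)) := by
    rw [show w = _ from funext fun n => funext (hwN n)]
    exact OneBitRadar.tendstoInDistribution_wVec hm Z hS hneg P N hN
  have hTlim : TendstoInDistribution T atTop id P (OneBitRadar.chiSquared 2) := by
    rw [show T = _ from funext fun n => funext (hTw n)]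
    exact OneBitRadar.tendstoInDistribution_sq_add_sq hwlim
  have hfa {γ : ℝ} (hγ : 0 ≤ γ) := OneBitRadar.tendsto_measureReal_lt_of_chiSquared hTlim hγ
  refine ⟨fun n _ ω => ⟨?_, hTw n ω⟩, fun n hn => ⟨OneBitRadar.uW_zero _,
    OneBitRadar.sigmaW_zero _, fun k => ?_, fun k l => ?_⟩, hwlim, hTlim,
    OneBitRadar.chiSquared_two_eq_expMeasure, OneBitRadar.integrable_id_chiSquared 2, ?_,
    fun γ hγ => ⟨OneBitRadar.chiSquared_two_real_Ioi hγ, hfa hγ⟩, fun α hα hα1 => ?_⟩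
  · rw [hT, OneBitRadar.raoStat_eq, hS, OneBitRadar.trace_mul_conjTranspose,
      OneBitRadar.normSq_zHy]
  · simp only [hwN, OneBitRadar.wVec_quantize, OneBitRadar.uW_zero]
    have hmap := (hN n).map_eq
    constructor
    · have h := OneBitRadar.memLp_signSum (OneBitRadar.wRe (Z n) k) (OneBitRadar.wIm (Z n) k) 2
      rw [← hmap] at h
      exact h.comp_of_map (hN n).aemeasurable
    · exact ((hN n).integral_comp (f := OneBitRadar.signSum _ _) (by fun_prop)).trans
        (OneBitRadar.integral_signSum _ _)
  -- Positivity of `n` matters here: for `n = 0` the vector `w` is zero and its covariance is not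
  -- the identity.
  · have hmn : (m : ℝ) * n ≠ 0 := by positivity
    simp only [hwN, OneBitRadar.wVec_quantize, OneBitRadar.sigmaW_zero]
    rw [(hN n).covariance_fun_comp (by fun_prop) (by fun_prop), OneBitRadar.covariance_signSum,
      OneBitRadar.sum_wRe_wIm hmn (hS n)]
  · exact_mod_cast OneBitRadar.integral_id_chiSquared 2
  · have hγ : 0 ≤ -2 * Real.log α := by linarith [Real.log_nonpos hα.le hα1]
    refine ⟨hγ, fun γ => ⟨fun h => ?_, fun h => ?_⟩, ?_⟩
    · rw [← h, Real.log_exp]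
      ring
    · rw [h, show -(-2 * Real.log α) / 2 = Real.log α by ring, Real.exp_log hα]
    · convert! hfa hγ using 2
      rw [show -(-2 * Real.log α) / 2 = Real.log α by ring, Real.exp_log hα]
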